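/- Write $e(x)=\exp(2\pi i x)$. For a prime $p$, an integer $n$ and a Dirichlet character $\chi$ modulo $p$ let $$S_p(n;\chi)=\sum_{a=1}^{p}\chi(a)\,e\!\left(\frac{na^3}{p}\right),$$ let $L(s,\chi)$ be the Dirichlet $L$-function of $\chi$, and let $\chi_0$ be the principal character modulo $p$. Let $$C=\prod_{q\ \mathrm{prime}}\ \sum_{m=0}^{\infty}\frac{\binom{2m}{m}^2}{4^{2m}q^{2m}},$$ let $r$ be the multiplicative function with $r(1)=1$ and $r(q^{\alpha})=\binom{2\alpha}{\alpha}/4^{\alpha}$ for primes $q$ and $\alpha\ge 1$, and for a positive integer $t$ put $$C_t=\sum_{s\mid t}\frac{r(s)\,r(st)}{s^2t}.$$ Theorem. There is an absolute constant $K$ such that the following holds. Let $p$ be a prime with $p\equiv 1\pmod 3$, let $n$ be an integer with $\gcd(n,p)=1$, let $1<a_1<p$ be a solution of $a_1^3\equiv 1\pmod p$, and let $1\le\overline{a}_1<p$ be the inverse of $a_1$ modulo $p$ (so that $a_1$ and $\overline{a}_1$ are the two solutions of $x^3\equiv 1\pmod p$ other than $1$). Then $$\left|\sum_{\chi\ne\chi_0}|S_p(n;\chi)|^2\,|L(1,\chi)|-C\,(1+C_{a_1}+C_{\overline{a}_1})\,p^2\right|\le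 K\,p^{3/2}\ln p,$$ where the sum is over all non-principal Dirichlet characters modulo $p$. In other words, the sum equals $C(1+C_{a_1}+C_{\overline{a}_1})p^2+O(p^{3/2}\ln p)$ with an absolute implied constant. -/

import Mathlib

/-- The additive character `e(x) = exp(2πix)`. -/
noncomputable def eAdd (x : ℝ) : ℂ := Complex.exp (2 * Real.pi * Complex.I * x)

/-- The cubic (Kummer) sum weighted by a Dirichlet character,
`S_p(n; χ) = ∑_{a=1}^{p} χ(a) e(n a³ / p)`. -/
noncomputable def kummerSum (p : ℕ) (n : ℤ) (χ : DirichletCharacter ℂ p) : ℂ :=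
  ∑ a ∈ Finset.Icc 1 p, χ (a : ZMod p) * eAdd ((n : ℝ) * (a : ℝ) ^ 3 / (p : ℝ))

/-- The multiplicative function `r` with `r(q^α) = binom(2α, α) / 4^α` at prime powers, `r(1) = 1`
(only used at positive integers). -/
noncomputable def rMul (n : ℕ) : ℝ :=
  n.factorization.prod fun _ α => (Nat.choose (2 * α) α : ℝ) / 4 ^ α

/-- The local factor `1 + binom(2,1)² / (4² q²) + ⋯ + binom(2m,m)² / (4^{2m} q^{2m}) + ⋯`;
the summand `m = 0` is the leading `1`. -/
noncomputable def localFactor (q : ℕ) : ℝ :=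
  ∑' m : ℕ, (Nat.choose (2 * m) m : ℝ) ^ 2 / (4 ^ (2 * m) * (q : ℝ) ^ (2 * m))

/-- The constant `C`, the product of the local factors over all primes. -/
noncomputable def constC : ℝ := ∏' q : Nat.Primes, localFactor q

/-- `C_t = ∑_{s ∣ t} r(s) r(st) / (s² t)`. -/
noncomputable def constCt (t : ℕ) : ℝ :=
  ∑ s ∈ t.divisors, rMul s * rMul (s * t) / ((s : ℝ) ^ 2 * (t : ℝ))

theorem localFactor_term_le (q m : ℕ) :
    (Nat.choose (2 * m) m : ℝ) ^ 2 / (4 ^ (2 * m) * (q : ℝ) ^ (2 * m))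
      ≤ (((q : ℝ) ^ 2)⁻¹) ^ m := by
  have h : (Nat.choose (2 * m) m : ℝ) ≤ 4 ^ m := by
    have h1 := Nat.choose_le_two_pow (2 * m) m
    rw [pow_mul] at h1
    exact_mod_cast h1
  have h2 : (Nat.choose (2 * m) m : ℝ) ^ 2 / 4 ^ (2 * m) ≤ 1 := by
    have h3 : (4 : ℝ) ^ (2 * m) = (4 ^ m) ^ 2 := by rw [← pow_mul, mul_comm]
    rw [div_le_one (by positivity), h3]
    gcongr
  calc _ = (Nat.choose (2 * m) m : ℝ) ^ 2 / 4 ^ (2 * m) * (((q : ℝ) ^ 2)⁻¹) ^ m := by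
        rw [inv_pow, ← pow_mul, ← div_eq_mul_inv, div_div]
    _ ≤ 1 * (((q : ℝ) ^ 2)⁻¹) ^ m := by gcongr
    _ = _ := one_mul _

/-- The series defining the local factor converges. -/
theorem summable_localFactor {q : ℕ} (hq : 2 ≤ q) :
    Summable fun m : ℕ =>
      (Nat.choose (2 * m) m : ℝ) ^ 2 / (4 ^ (2 * m) * (q : ℝ) ^ (2 * m)) := by
  have hq' : (2 : ℝ) ≤ q := by exact_mod_cast hq
  refine Summable.of_nonneg_of_le (fun m => by positivity) (localFactor_term_le q)
    (summable_geometric_of_lt_one (by positivity) ?_)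
  apply inv_lt_one_of_one_lt₀
  nlinarith

/-- The product defining `C` converges (unconditionally). -/
theorem multipliable_localFactor : Multipliable fun q : Nat.Primes => localFactor q := by
  have key : ∀ q : Nat.Primes, 0 ≤ localFactor q - 1 ∧
      localFactor q - 1 ≤ 2 * (((q : ℕ) : ℝ) ^ 2)⁻¹ := by
    intro q
    have hq : (2 : ℝ) ≤ ((q : ℕ) : ℝ) := by exact_mod_cast q.2.two_le
    have hs := summable_localFactor q.2.two_le
    have hx : (((q : ℕ) : ℝ) ^ 2)⁻¹ ≤ 1 / 2 := by
      rw [inv_le_comm₀ (by positivity) (by norm_num)]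
      nlinarith
    have hx0 : 0 ≤ (((q : ℕ) : ℝ) ^ 2)⁻¹ := by positivity
    generalize hxd : (((q : ℕ) : ℝ) ^ 2)⁻¹ = x at hx hx0 ⊢
    have hx1 : x < 1 := by linarith
    have hg := summable_geometric_of_lt_one hx0 hx1
    constructor
    · have := hs.le_tsum 0 (fun m _ => by positivity)
      simp at this
      rw [localFactor]
      linarith
    · have h1 : localFactor q ≤ ∑' m : ℕ, x ^ m :=
        hs.tsum_le_tsum (fun m => hxd ▸ localFactor_term_le q m) hg
      rw [tsum_geometric_of_lt_one hx0 hx1] at h1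
      have h2 : (1 - x)⁻¹ ≤ 1 + 2 * x := by
        rw [inv_le_iff_one_le_mul₀ (by linarith)]
        nlinarith
      linarith
  have hsum : Summable fun q : Nat.Primes => localFactor q - 1 := by
    refine Summable.of_nonneg_of_le (fun q => (key q).1) (fun q => (key q).2) ?_
    refine Summable.mul_left 2 ?_
    exact (Real.summable_nat_pow_inv.mpr one_lt_two).comp_injective Subtype.val_injective
  have := Real.multipliable_one_add_of_summable hsum
  simpa using this

/-! ### The multiplicative function `r` -/

/-! Since `r * r = 1` under Dirichlet convolution, `L(1, χ)` is formally the square of `∑ r(n) χ(n)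
/ n`, so `|L(1, χ)|` can be replaced by `|rPoly χ|²`, the sum being cut at `p - 1`. This removes the
absolute value and leaves a quadratic expression that orthogonality can evaluate.

Replacement: `L(1, χ) - rPoly χ ^ 2` is a Dirichlet polynomial supported on `p ≤ k ≤ p²`, plus a
tail at most `1 / p`. By Cauchy–Schwarz its cost is the fourth moment of `kummerSum`, which is
`O(p³)`, against the second moment of that polynomial, which is `O(log² p)`.

Main term: orthogonality turns `∑ |kummerSum|² |rPoly|²` into `p - 1` times a double sum over units
`v, v'` of `r(v) r(v') / (v v')` times a cubic exponential sum at `n (v⁻³ - v'⁻³)`. The diagonal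
gives `(p - 1)² ∑ r(k)² / k²`, close to `C p²` by the Euler product. If `v³ ≠ v'³`, the cubic sum is
`O(√p)`. If `v³ = v'³` with `v ≠ v'`, then `p ∣ v² + v v' + v'²`, which forces `v + v' ≥ √p` and
makes the weights small.

The same divisibility gives `a₁ + 1 ≥ √p`, hence `C_{a₁} = O(p^{-1/2})`, and likewise for the
inverse. Both secondary terms are therefore absorbed by the error. -/

theorem sum_antidiagonal_centralBinom_mul (n : ℕ) :
    ∑ x ∈ Finset.HasAntidiagonal.antidiagonal n, Nat.centralBinom x.1 * Nat.centralBinom x.2 = 4 ^ n := by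
  induction n with
  | zero => simp
  | succ k ih =>
    -- By the symmetry of the convolution, weighting by the first index is half of weighting by the
    -- total. Combined with `(i + 1) b_{i+1} = (4 i + 2) b_i`, this gives the recurrence `A_{k+1} =
    -- 4 A_k`.
    have fst_weighted : ∀ m : ℕ, 2 * ∑ x ∈ Finset.HasAntidiagonal.antidiagonal m,
        x.1 * (Nat.centralBinom x.1 * Nat.centralBinom x.2)
        = m * ∑ x ∈ Finset.HasAntidiagonal.antidiagonal m, Nat.centralBinom x.1 * Nat.centralBinom x.2 := by
      intro m
      have hswap : ∑ x ∈ Finset.HasAntidiagonal.antidiagonal m,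
          x.1 * (Nat.centralBinom x.1 * Nat.centralBinom x.2)
          = ∑ x ∈ Finset.HasAntidiagonal.antidiagonal m,
            x.2 * (Nat.centralBinom x.1 * Nat.centralBinom x.2) := by
        rw [← Finset.Nat.sum_antidiagonal_swap]
        refine Finset.sum_congr rfl fun x _ => ?_
        simp only [Prod.fst_swap, Prod.snd_swap]
        ring
      rw [two_mul]
      nth_rewrite 2 [hswap]
      rw [← Finset.sum_add_distrib, Finset.mul_sum]
      refine Finset.sum_congr rfl fun x hx => ?_
      rw [← Finset.HasAntidiagonal.mem_antidiagonal.1 hx]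
      ring
    have h1 := fst_weighted (k + 1)
    have h0 := fst_weighted k
    rw [Finset.Nat.sum_antidiagonal_succ] at h1
    have h2 : ∀ x ∈ Finset.HasAntidiagonal.antidiagonal k,
        (x.1 + 1) * (Nat.centralBinom (x.1 + 1) * Nat.centralBinom x.2)
        = 4 * (x.1 * (Nat.centralBinom x.1 * Nat.centralBinom x.2))
          + 2 * (Nat.centralBinom x.1 * Nat.centralBinom x.2) := by
      intro x _
      rw [← mul_assoc, Nat.succ_mul_centralBinom_succ]
      ring
    simp only [zero_mul, zero_add] at h1
    rw [Finset.sum_congr rfl h2, Finset.sum_add_distrib, ← Finset.mul_sum, ← Finset.mul_sum,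
      ih] at h1
    rw [ih] at h0
    have h3 : (k + 1) * ∑ x ∈ Finset.HasAntidiagonal.antidiagonal (k + 1),
        Nat.centralBinom x.1 * Nat.centralBinom x.2 = (k + 1) * 4 ^ (k + 1) := by
      rw [← h1, pow_succ]
      linarith
    exact Nat.eq_of_mul_eq_mul_left (Nat.succ_pos k) h3

theorem rMul_one : rMul 1 = 1 := by simp [rMul]

theorem rMul_nonneg (n : ℕ) : 0 ≤ rMul n := by
  rw [rMul, Finsupp.prod]
  exact Finset.prod_nonneg fun q _ => by positivity

theorem rMul_le_one (n : ℕ) : rMul n ≤ 1 := by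
  rw [rMul, Finsupp.prod]
  refine Finset.prod_le_one (fun q _ => by positivity) fun q _ => ?_
  rw [div_le_one (by positivity)]
  have h1 := Nat.choose_le_two_pow (2 * n.factorization q) (n.factorization q)
  rw [pow_mul] at h1
  exact_mod_cast h1

theorem rMul_mul_of_coprime {m n : ℕ} (h : m.Coprime n) : rMul (m * n) = rMul m * rMul n := by
  rw [rMul, Nat.factorization_mul_of_coprime h, Finsupp.prod_add_index_of_disjoint]
  · rfl
  · simpa using h.disjoint_primeFactors

theorem rMul_prime_pow {q : ℕ} (hq : q.Prime) (k : ℕ) :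
    rMul (q ^ k) = (Nat.choose (2 * k) k : ℝ) / 4 ^ k := by
  rw [rMul, hq.factorization_pow, Finsupp.prod_single_index]
  simp

/-- `r` as an arithmetic function. -/
noncomputable def rArith : ArithmeticFunction ℝ := ⟨fun n => if n = 0 then 0 else rMul n, by simp⟩

theorem rArith_apply {n : ℕ} (hn : n ≠ 0) : rArith n = rMul n := if_neg hn

theorem rArith_isMultiplicative : rArith.IsMultiplicative := by
  rw [ArithmeticFunction.IsMultiplicative.iff_ne_zero]
  refine ⟨by rw [rArith_apply one_ne_zero, rMul_one], fun {m n} hm hn h => ?_⟩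
  rw [rArith_apply hm, rArith_apply hn, rArith_apply (mul_ne_zero hm hn), rMul_mul_of_coprime h]

/-- `r` is the Dirichlet convolution square root of `ζ`. -/
theorem rArith_mul_self : rArith * rArith = ((ArithmeticFunction.zeta : ArithmeticFunction ℕ) :
    ArithmeticFunction ℝ) := by
  rw [ArithmeticFunction.IsMultiplicative.eq_iff_eq_on_prime_powers _
    (rArith_isMultiplicative.mul rArith_isMultiplicative) _
    ArithmeticFunction.isMultiplicative_zeta.natCast]
  intro q k hq
  have hterm : ∀ i ∈ Finset.range (k + 1), rArith (q ^ i) * rArith (q ^ k / q ^ i)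
      = (Nat.centralBinom i * Nat.centralBinom (k - i) : ℕ) / 4 ^ k := by
    intro i hi
    have hik : i ≤ k := Nat.lt_succ_iff.1 (Finset.mem_range.1 hi)
    rw [Nat.pow_div hik hq.pos, rArith_apply (pow_ne_zero _ hq.ne_zero),
      rArith_apply (pow_ne_zero _ hq.ne_zero), rMul_prime_pow hq, rMul_prime_pow hq,
      div_mul_div_comm, ← pow_add, Nat.add_sub_cancel' hik, Nat.centralBinom, Nat.centralBinom,
      Nat.cast_mul]
  rw [ArithmeticFunction.mul_apply,
    Nat.sum_divisorsAntidiagonal (fun a b => rArith a * rArith b), Nat.sum_divisors_prime_pow hq,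
    Finset.sum_congr rfl hterm, ← Finset.sum_div, ← Nat.cast_sum,
    ← Finset.Nat.sum_antidiagonal_eq_sum_range_succ
      (fun a b => Nat.centralBinom a * Nat.centralBinom b),
    sum_antidiagonal_centralBinom_mul, ArithmeticFunction.natCoe_apply,
    ArithmeticFunction.zeta_apply_ne (pow_ne_zero _ hq.ne_zero)]
  simp

theorem sum_divisorsAntidiagonal_rMul {n : ℕ} (hn : n ≠ 0) :
    ∑ x ∈ n.divisorsAntidiagonal, rMul x.1 * rMul x.2 = 1 := by
  have h := congrArg (fun f : ArithmeticFunction ℝ => f n) rArith_mul_self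
  simp only [ArithmeticFunction.mul_apply, ArithmeticFunction.natCoe_apply,
    ArithmeticFunction.zeta_apply, hn, if_false, Nat.cast_one] at h
  rw [← h]
  refine Finset.sum_congr rfl fun x hx => ?_
  rw [Nat.mem_divisorsAntidiagonal] at hx
  have h1 : x.1 ≠ 0 := fun h0 => hn (by rw [← hx.1, h0, zero_mul])
  have h2 : x.2 ≠ 0 := fun h0 => hn (by rw [← hx.1, h0, mul_zero])
  rw [rArith_apply h1, rArith_apply h2]

theorem summable_rMul_sq_div_sq : Summable fun n : ℕ => rMul n ^ 2 / (n : ℝ) ^ 2 := by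
  refine Summable.of_nonneg_of_le (fun n => by positivity) (fun n => ?_)
    (Real.summable_nat_pow_inv.mpr one_lt_two)
  rw [← one_div]
  gcongr
  exact pow_le_one₀ (rMul_nonneg n) (rMul_le_one n)

/-- Euler product of the multiplicative function `r(n)² / n²`; the diagonal terms produce `C` in
this form. The index `n = 0` contributes nothing, because division by zero gives zero. -/
theorem constC_eq_tsum : constC = ∑' n : ℕ, rMul n ^ 2 / (n : ℝ) ^ 2 := by
  rw [constC, ← EulerProduct.eulerProduct_tprod (f := fun n : ℕ => rMul n ^ 2 / (n : ℝ) ^ 2)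
    (by simp [rMul_one]) _ summable_rMul_sq_div_sq.norm (by simp)]
  · refine tprod_congr fun q => tsum_congr fun m => ?_
    rw [rMul_prime_pow q.2, div_pow, ← pow_mul, mul_comm m 2, Nat.cast_pow, ← pow_mul,
      mul_comm m 2, div_div]
  · intro m n h
    rw [rMul_mul_of_coprime h, Nat.cast_mul]
    ring

theorem constC_nonneg : 0 ≤ constC := by
  rw [constC_eq_tsum]
  exact tsum_nonneg fun n => by positivity

theorem sum_Icc_rMul_sq_le_constC (N : ℕ) :
    ∑ n ∈ Finset.Icc 1 N, rMul n ^ 2 / (n : ℝ) ^ 2 ≤ constC := by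
  rw [constC_eq_tsum]
  exact summable_rMul_sq_div_sq.sum_le_tsum _ fun n _ => by positivity

theorem constC_le_sum_Icc_add (N : ℕ) :
    constC ≤ ∑ n ∈ Finset.Icc 1 N, rMul n ^ 2 / (n : ℝ) ^ 2 + 2 / (N + 1) := by
  rw [constC_eq_tsum]
  refine Real.tsum_le_of_sum_range_le (fun n => by positivity) fun M => ?_
  have hsub : Finset.range M ⊆ Finset.range 1 ∪ (Finset.Icc 1 N ∪ Finset.Ioo N M) := by
    intro x hx
    simp only [Finset.mem_range, Finset.mem_union, Finset.mem_Icc, Finset.mem_Ioo] at hx ⊢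
    omega
  have hpos : ∀ n : ℕ, 0 ≤ rMul n ^ 2 / (n : ℝ) ^ 2 := fun n => by positivity
  have hunion : ∀ s t : Finset ℕ, ∑ n ∈ s ∪ t, rMul n ^ 2 / (n : ℝ) ^ 2
      ≤ ∑ n ∈ s, rMul n ^ 2 / (n : ℝ) ^ 2 + ∑ n ∈ t, rMul n ^ 2 / (n : ℝ) ^ 2 := by
    intro s t
    rw [← Finset.sum_union_inter]
    exact le_add_of_nonneg_right (Finset.sum_nonneg fun n _ => hpos n)
  refine (Finset.sum_le_sum_of_subset_of_nonneg hsub fun n _ _ => hpos n).trans ?_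
  refine (hunion _ _).trans ?_
  rw [Finset.sum_range_one, Nat.cast_zero, zero_pow two_ne_zero, div_zero, zero_add]
  refine (hunion _ _).trans (add_le_add_right ?_ _)
  refine le_trans (Finset.sum_le_sum fun n _ => ?_) (sum_Ioo_inv_sq_le N M)
  rw [← one_div]
  gcongr
  exact pow_le_one₀ (rMul_nonneg n) (rMul_le_one n)

theorem constCt_nonneg (t : ℕ) : 0 ≤ constCt t :=
  Finset.sum_nonneg fun s _ =>
    div_nonneg (mul_nonneg (rMul_nonneg _) (rMul_nonneg _)) (by positivity)

/-- Bounding `r` by 1 leaves `(1 / t) ∑ 1 / s²`. The decay in `t` is what makes the secondary terms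
negligible. -/
theorem constCt_le (t : ℕ) : constCt t ≤ 2 / t := by
  have h1 : ∀ s ∈ t.divisors, rMul s * rMul (s * t) / ((s : ℝ) ^ 2 * (t : ℝ))
      ≤ ((s : ℝ) ^ 2)⁻¹ * (1 / t) := by
    intro s _
    rw [← one_div, div_mul_div_comm, one_mul]
    gcongr
    exact mul_le_one₀ (rMul_le_one _) (rMul_nonneg _) (rMul_le_one _)
  refine (Finset.sum_le_sum h1).trans ?_
  rw [← Finset.sum_mul, div_eq_mul_one_div 2]
  refine mul_le_mul_of_nonneg_right ?_ (by positivity)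
  refine (Finset.sum_le_sum_of_subset_of_nonneg (t := Finset.Ioo 0 (t + 1)) ?_
    fun _ _ _ => by positivity).trans ((sum_Ioo_inv_sq_le 0 (t + 1)).trans (by norm_num))
  intro s hs
  rw [Finset.mem_Ioo]
  exact ⟨Nat.pos_of_mem_divisors hs, Nat.lt_succ_of_le (Nat.divisor_le hs)⟩

theorem sum_Icc_one_div_le (N : ℕ) : ∑ n ∈ Finset.Icc 1 N, 1 / (n : ℝ) ≤ 1 + Real.log N := by
  have := harmonic_le_one_add_log N
  rw [harmonic_eq_sum_Icc] at this
  push_cast at this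
  simpa [one_div] using this

/-- The coefficients of the square of the truncation at `N` of the Dirichlet series of `r`. -/
noncomputable def rConv (N k : ℕ) : ℝ :=
  ∑ x ∈ k.divisorsAntidiagonal with x.1 ≤ N ∧ x.2 ≤ N, rMul x.1 * rMul x.2

theorem rConv_nonneg (N k : ℕ) : 0 ≤ rConv N k :=
  Finset.sum_nonneg fun _ _ => mul_nonneg (rMul_nonneg _) (rMul_nonneg _)

theorem rConv_le_one (N k : ℕ) : rConv N k ≤ 1 := by
  rcases eq_or_ne k 0 with rfl | hk
  · simp [rConv]
  · rw [← sum_divisorsAntidiagonal_rMul hk]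
    exact Finset.sum_le_sum_of_subset_of_nonneg (Finset.filter_subset _ _)
      fun _ _ _ => mul_nonneg (rMul_nonneg _) (rMul_nonneg _)

theorem rConv_eq_one {N k : ℕ} (hk : k ≠ 0) (hkN : k ≤ N) : rConv N k = 1 := by
  rw [← sum_divisorsAntidiagonal_rMul hk, rConv, Finset.filter_true_of_mem]
  intro x hx
  have hx' := Nat.mem_divisorsAntidiagonal.1 hx
  have h1 : x.1 ∣ k := Dvd.intro _ hx'.1
  have h2 : x.2 ∣ k := Dvd.intro_left _ hx'.1
  have hp := Nat.pos_of_ne_zero hk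
  exact ⟨(Nat.le_of_dvd hp h1).trans hkN, (Nat.le_of_dvd hp h2).trans hkN⟩

/-- Stated over a general algebra to serve both `f n = 1 / n` over `ℝ` and `f n = χ(n) / n` over
`ℂ`. Any `X ≥ N²` captures every product of two indices up to `N`. -/
theorem sum_rMul_mul_sum_rMul {R : Type*} [CommRing R] [Algebra ℝ R] (N X : ℕ) (hX : N ^ 2 ≤ X)
    (f : ℕ → R) (hf : ∀ a b, f (a * b) = f a * f b) :
    (∑ n ∈ Finset.Icc 1 N, algebraMap ℝ R (rMul n) * f n) ^ 2
      = ∑ k ∈ Finset.Icc 1 X, algebraMap ℝ R (rConv N k) * f k := by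
  have h1 : ∀ k ∈ Finset.Icc 1 X, algebraMap ℝ R (rConv N k) * f k
      = ∑ x ∈ Finset.Icc 1 N ×ˢ Finset.Icc 1 N with x.1 * x.2 = k,
        (algebraMap ℝ R (rMul x.1) * f x.1) * (algebraMap ℝ R (rMul x.2) * f x.2) := by
    intro k hk
    rw [rConv, map_sum, Finset.sum_mul]
    refine Finset.sum_congr ?_ fun x hx => ?_
    · ext x
      simp only [Finset.mem_Icc] at hk
      simp only [Finset.mem_filter, Nat.mem_divisorsAntidiagonal, Finset.mem_product,
        Finset.mem_Icc]
      constructor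
      · rintro ⟨⟨rfl, h0⟩, h1, h2⟩
        have := mul_ne_zero_iff.1 h0
        exact ⟨⟨⟨by omega, h1⟩, by omega, h2⟩, rfl⟩
      · rintro ⟨⟨⟨h1, h2⟩, h3, h4⟩, h5⟩
        exact ⟨⟨h5, by omega⟩, h2, h4⟩
    · rw [← (Finset.mem_filter.1 hx).2, hf, map_mul]
      ring
  rw [Finset.sum_congr rfl h1, sq, Finset.sum_mul_sum, ← Finset.sum_product',
    Finset.sum_fiberwise_of_maps_to]
  intro x hx
  simp only [Finset.mem_product, Finset.mem_Icc] at hx ⊢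
  obtain ⟨⟨h1, h2⟩, h3, h4⟩ := hx
  exact ⟨Nat.mul_pos h1 h3, (Nat.mul_le_mul h2 h4).trans (by rw [← sq]; exact hX)⟩

/-- Squaring first and using `rConv ≤ 1` bounds the square by a harmonic sum. Bounding `r` by 1 at
once would give `log²`, one logarithm too many for the final error. -/
theorem sum_rMul_div_sq_le (N : ℕ) :
    (∑ n ∈ Finset.Icc 1 N, rMul n / (n : ℝ)) ^ 2 ≤ 1 + 2 * Real.log N := by
  have h := sum_rMul_mul_sum_rMul (R := ℝ) N (N ^ 2) le_rfl (fun n => ((n : ℝ))⁻¹)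
    (fun a b => by simp [mul_comm])
  simp only [Algebra.algebraMap_self, RingHom.id_apply, ← div_eq_mul_inv] at h
  rw [h]
  calc _ ≤ ∑ k ∈ Finset.Icc 1 (N ^ 2), 1 / (k : ℝ) := by
        gcongr
        exact rConv_le_one _ _
    _ ≤ 1 + Real.log ((N ^ 2 : ℕ) : ℝ) := sum_Icc_one_div_le _
    _ = _ := by rw [Nat.cast_pow, Real.log_pow]; norm_num

/-! ### Truncating `L(1, χ)` -/

theorem norm_sum_range_mul_le_of_antitone {g : ℕ → ℝ} (hg : Antitone g) (hg0 : ∀ n, 0 ≤ g n)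
    {a : ℕ → ℂ} {B : ℝ} (hB : ∀ n, ‖∑ i ∈ Finset.range n, a i‖ ≤ B) (n : ℕ) :
    ‖∑ i ∈ Finset.range n, g i • a i‖ ≤ B * g 0 := by
  have hB0 : 0 ≤ B := (norm_nonneg _).trans (hB 0)
  rw [Finset.sum_range_by_parts]
  have h1 : ‖g (n - 1) • ∑ i ∈ Finset.range n, a i‖ ≤ g (n - 1) * B := by
    rw [norm_smul, Real.norm_of_nonneg (hg0 _)]
    exact mul_le_mul_of_nonneg_left (hB n) (hg0 _)
  have h2 : ‖∑ i ∈ Finset.range (n - 1), (g (i + 1) - g i) • ∑ j ∈ Finset.range (i + 1), a j‖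
      ≤ ∑ i ∈ Finset.range (n - 1), (g i - g (i + 1)) * B := by
    refine norm_sum_le_of_le _ fun i _ => ?_
    have hle := hg (Nat.le_succ i)
    rw [norm_smul, ← norm_neg, neg_sub, Real.norm_of_nonneg (sub_nonneg.2 hle)]
    exact mul_le_mul_of_nonneg_left (hB _) (sub_nonneg.2 hle)
  rw [← Finset.sum_mul, Finset.sum_range_sub'] at h2
  calc _ ≤ _ := norm_sub_le _ _
    _ ≤ _ := add_le_add h1 h2
    _ = _ := by ring

section Truncation

variable {p : ℕ} [Fact p.Prime]

/-- Full periods cancel, leaving fewer than `p` terms. This trivial bound suffices because `L(1, χ)`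
is truncated as late as `p²`. -/
theorem norm_sum_range_dirichletCharacter_le {χ : DirichletCharacter ℂ p} (hχ : χ ≠ 1) (n : ℕ) :
    ‖∑ i ∈ Finset.range n, χ (i : ZMod p)‖ ≤ p := by
  have hp : 0 < p := (Fact.out : p.Prime).pos
  have hperiod : ∑ i ∈ Finset.range p, χ (i : ZMod p) = 0 := by
    rw [← MulChar.sum_eq_zero_of_ne_one hχ]
    refine Finset.sum_bij' (fun i _ => (i : ZMod p)) (fun a _ => a.val) (fun _ _ => by simp)
      (fun a _ => by simpa using ZMod.val_lt a)
      (fun i hi => ZMod.val_cast_of_lt (Finset.mem_range.1 hi)) (fun a _ => by simp)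
      (fun _ _ => rfl)
  induction n using Nat.strong_induction_on with
  | _ n ih =>
    rcases lt_or_ge n p with h | h
    · refine (norm_sum_le_of_le _ (f := fun i : ℕ => χ (i : ZMod p)) (n := fun _ => (1 : ℝ))
        fun i _ => χ.norm_le_one _).trans ?_
      simpa using h.le
    · obtain ⟨m, rfl⟩ := Nat.exists_eq_add_of_le h
      rw [Finset.sum_range_add, hperiod, zero_add]
      simpa using ih m (by omega)

/-- For real `s > 1` the series converges absolutely, and partial summation bounds the tail by `p ·
p⁻²` uniformly in `s`. Continuity of both sides then gives the bound at `s = 1`. -/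
theorem norm_LFunction_sub_sum_le {χ : DirichletCharacter ℂ p} (hχ : χ ≠ 1) :
    ‖DirichletCharacter.LFunction χ 1 - ∑ n ∈ Finset.Icc 1 (p ^ 2), χ (n : ZMod p) / (n : ℂ)‖
      ≤ 1 / p := by
  have hp : 0 < p := (Fact.out : p.Prime).pos
  have hp' : (0 : ℝ) < p := by exact_mod_cast hp
  have key : ∀ s : ℝ, 1 < s → ‖DirichletCharacter.LFunction χ s
      - ∑ n ∈ Finset.Icc 1 (p ^ 2), χ (n : ZMod p) / (n : ℂ) ^ (s : ℂ)‖ ≤ 1 / p := by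
    intro s hs
    have hs' : 1 < (s : ℂ).re := by simpa using hs
    rw [DirichletCharacter.LFunction_eq_LSeries χ hs']
    have hsum : LSeriesSummable (fun n => χ (n : ZMod p)) s :=
      ZMod.LSeriesSummable_of_one_lt_re χ hs'
    have hterm : ∀ n : ℕ, LSeries.term (fun n => χ (n : ZMod p)) s n
        = χ (n : ZMod p) / (n : ℂ) ^ (s : ℂ) := by
      intro n
      rcases eq_or_ne n 0 with rfl | hn
      · simp [Complex.zero_cpow (by exact_mod_cast (by linarith : s ≠ 0) : (s : ℂ) ≠ 0)]
      · rw [LSeries.term_of_ne_zero hn]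
    have hlim : Filter.Tendsto (fun M => ∑ n ∈ Finset.range M,
        LSeries.term (fun n => χ (n : ZMod p)) s n) Filter.atTop
        (nhds (LSeries (fun n => χ (n : ZMod p)) s)) := hsum.hasSum.tendsto_sum_nat
    have hlim2 := ((hlim.comp (Filter.tendsto_add_atTop_nat (p ^ 2 + 1))).sub_const
      (∑ n ∈ Finset.Icc 1 (p ^ 2), χ (n : ZMod p) / (n : ℂ) ^ (s : ℂ))).norm
    refine le_of_tendsto' hlim2 fun M => ?_
    have hsplit : ∑ n ∈ Finset.Icc 1 (p ^ 2), χ (n : ZMod p) / (n : ℂ) ^ (s : ℂ)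
        = ∑ n ∈ Finset.range (p ^ 2 + 1), LSeries.term (fun n => χ (n : ZMod p)) s n := by
      rw [Finset.sum_range_succ', LSeries.term_zero, add_zero, Finset.range_eq_Ico,
        Finset.sum_Ico_add' (fun n => LSeries.term (fun n => χ (n : ZMod p)) s n) 0 (p ^ 2) 1]
      exact Finset.sum_congr rfl fun n _ => (hterm n).symm
    rw [hsplit, Function.comp, add_comm M, Finset.sum_range_add, add_sub_cancel_left]
    set g : ℕ → ℝ := fun k => ((p ^ 2 + 1 + k : ℕ) : ℝ) ^ (-s) with hg
    have hanti : Antitone g := by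
      intro a b hab
      refine Real.rpow_le_rpow_of_nonpos (by positivity) ?_ (by linarith)
      exact_mod_cast (by omega)
    -- The tail starts at `p² + 1 ≡ 1`, so its partial sums are those of `χ` from 1; adding the
    -- index 0 changes nothing, as `χ 0 = 0`.
    have hpart : ∀ n, ‖∑ i ∈ Finset.range n, χ ((i + 1 : ℕ) : ZMod p)‖ ≤ p := by
      intro n
      have h := norm_sum_range_dirichletCharacter_le hχ (n + 1)
      rw [Finset.sum_range_succ'] at h
      rwa [Nat.cast_zero, χ.map_zero, add_zero] at h
    have habel := norm_sum_range_mul_le_of_antitone hanti (fun n => by positivity) hpart M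
    have hcongr : ∑ k ∈ Finset.range M, LSeries.term (fun n => χ (n : ZMod p)) s (p ^ 2 + 1 + k)
        = ∑ k ∈ Finset.range M, g k • χ ((k + 1 : ℕ) : ZMod p) := by
      refine Finset.sum_congr rfl fun k _ => ?_
      simp only [hg]
      rw [hterm, Complex.real_smul, Real.rpow_neg (by positivity), Complex.ofReal_inv,
        Complex.ofReal_cpow (by positivity), Complex.ofReal_natCast, div_eq_inv_mul]
      congr 2
      push_cast
      rw [CharP.cast_eq_zero]
      ring
    rw [hcongr]
    refine habel.trans ?_
    have hg0 : g 0 ≤ ((p : ℝ) ^ 2)⁻¹ := by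
      have h1 : ((p : ℝ) ^ 2 + 1) ^ (-s) ≤ ((p : ℝ) ^ 2 + 1) ^ (-1 : ℝ) :=
        Real.rpow_le_rpow_of_exponent_le (by nlinarith) (by linarith)
      rw [Real.rpow_neg_one] at h1
      have h2 : ((p : ℝ) ^ 2 + 1)⁻¹ ≤ ((p : ℝ) ^ 2)⁻¹ := by gcongr; linarith
      simpa [hg] using h1.trans h2
    calc (p : ℝ) * g 0 ≤ p * ((p : ℝ) ^ 2)⁻¹ := by gcongr
      _ = 1 / p := by field_simp
  have hcont : Filter.Tendsto (fun s : ℝ => ‖DirichletCharacter.LFunction χ s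
      - ∑ n ∈ Finset.Icc 1 (p ^ 2), χ (n : ZMod p) / (n : ℂ) ^ (s : ℂ)‖)
      (nhdsWithin 1 (Set.Ioi 1)) (nhds ‖DirichletCharacter.LFunction χ (1 : ℝ)
      - ∑ n ∈ Finset.Icc 1 (p ^ 2), χ (n : ZMod p) / (n : ℂ) ^ ((1 : ℝ) : ℂ)‖) := by
    refine tendsto_nhdsWithin_of_tendsto_nhds (Continuous.tendsto ?_ 1)
    refine continuous_norm.comp (Continuous.sub
      ((DirichletCharacter.differentiable_LFunction hχ).continuous.comp Complex.continuous_ofReal)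
      (continuous_finsetSum _ fun n hn => ?_))
    have hn0 : (n : ℂ) ≠ 0 := by
      have := (Finset.mem_Icc.1 hn).1
      exact_mod_cast (by omega : n ≠ 0)
    refine continuous_const.div (Complex.continuous_ofReal.const_cpow (Or.inl hn0)) fun s => ?_
    simp [Complex.cpow_eq_zero_iff, hn0]
  have := le_of_tendsto hcont (Filter.eventually_of_mem self_mem_nhdsWithin fun s hs => key s hs)
  simpa using this

end Truncation

/-! ### Orthogonality of characters and cubic sums -/

section CubicSums

variable {p : ℕ} [Fact p.Prime]

/-- Parseval on the group of units; `p - 1` is the number of characters. -/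
theorem sum_norm_sq_sum_units (f : (ZMod p)ˣ → ℂ) :
    ∑ χ : DirichletCharacter ℂ p, ‖∑ u : (ZMod p)ˣ, χ (u : ZMod p) * f u‖ ^ 2
      = ((p : ℝ) - 1) * ∑ u, ‖f u‖ ^ 2 := by
  have hp := (Fact.out : p.Prime)
  have hcast : ((p.totient : ℕ) : ℂ) = (p : ℂ) - 1 := by
    rw [Nat.totient_prime hp, Nat.cast_sub hp.one_le, Nat.cast_one]
  have hconj : ∀ (χ : DirichletCharacter ℂ p) (u : (ZMod p)ˣ),
      (starRingEnd ℂ) (χ (u : ZMod p)) = χ ((u : ZMod p)⁻¹) := by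
    intro χ u
    rw [starRingEnd_apply, MulChar.star_apply', MulChar.inv_apply']
  rw [← Complex.ofReal_inj]
  push_cast
  simp_rw [← Complex.conj_mul', map_sum, map_mul, hconj, Finset.sum_mul_sum]
  rw [Finset.sum_comm, Finset.mul_sum]
  refine Finset.sum_congr rfl fun u _ => ?_
  rw [Finset.sum_comm]
  have hinner : ∀ v : (ZMod p)ˣ, ∑ χ : DirichletCharacter ℂ p,
      χ ((u : ZMod p)⁻¹) * (starRingEnd ℂ) (f u) * (χ (v : ZMod p) * f v)
      = if u = v then ((p : ℂ) - 1) * ((starRingEnd ℂ) (f u) * f v) else 0 := by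
    intro v
    have h := DirichletCharacter.sum_char_inv_mul_char_eq ℂ u.isUnit (v : ZMod p)
    rw [hcast] at h
    have h2 : ∑ χ : DirichletCharacter ℂ p,
        χ ((u : ZMod p)⁻¹) * (starRingEnd ℂ) (f u) * (χ (v : ZMod p) * f v)
        = (∑ χ : DirichletCharacter ℂ p, χ ((u : ZMod p)⁻¹) * χ (v : ZMod p))
          * ((starRingEnd ℂ) (f u) * f v) := by
      rw [Finset.sum_mul]
      exact Finset.sum_congr rfl fun χ _ => by ring
    rw [h2, h]
    simp only [Units.val_inj]
    split_ifs <;> simp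
  rw [Finset.sum_congr rfl fun v _ => hinner v]
  simp

theorem card_filter_cube_eq_le (m : ZMod p) :
    (Finset.univ.filter fun t : (ZMod p)ˣ => (t : ZMod p) ^ 3 = m).card ≤ 3 := by
  classical
  refine le_trans ?_ (Polynomial.card_nthRoots 3 m)
  refine le_trans ?_ (Multiset.toFinset_card_le _)
  refine Finset.card_le_card_of_injOn (fun t : (ZMod p)ˣ => (t : ZMod p)) (fun t ht => ?_)
    fun a _ b _ h => Units.ext h
  simpa [Polynomial.mem_nthRoots] using ht

/-- The cubic exponential sum over nonzero residues. -/
noncomputable def cubicSum (c : ZMod p) : ℂ :=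
  ∑ b : (ZMod p)ˣ, ZMod.stdAddChar (c * (b : ZMod p) ^ 3)

theorem card_units_eq : ((Fintype.card (ZMod p)ˣ : ℕ) : ℝ) = (p : ℝ) - 1 := by
  have hp := (Fact.out : p.Prime)
  rw [ZMod.card_units, Nat.cast_sub hp.one_le, Nat.cast_one]

theorem cubicSum_zero : cubicSum (0 : ZMod p) = (p : ℂ) - 1 := by
  have h : ((Fintype.card (ZMod p)ˣ : ℕ) : ℂ) = (p : ℂ) - 1 := by
    exact_mod_cast congrArg Complex.ofReal (card_units_eq (p := p))
  simp [cubicSum, ← h]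

theorem cubicSum_mul_cube (c : ZMod p) (t : (ZMod p)ˣ) :
    cubicSum (c * (t : ZMod p) ^ 3) = cubicSum c := by
  refine Fintype.sum_equiv (Equiv.mulLeft t) _ _ fun b => ?_
  simp only [Equiv.coe_mulLeft, Units.val_mul]
  ring_nf

theorem norm_sq_sum_eq {ι : Type*} [Fintype ι] (f : ι → ℂ) :
    ((‖∑ i, f i‖ ^ 2 : ℝ) : ℂ) = ∑ i, ∑ j, f i * (starRingEnd ℂ) (f j) := by
  rw [Complex.ofReal_pow, ← Complex.mul_conj', map_sum, Finset.sum_mul_sum]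

/-- Additive orthogonality leaves `p` times the number of pairs of units with equal cubes, and each
unit has at most three partners. -/
theorem sum_norm_cubicSum_sq_le : ∑ c : ZMod p, ‖cubicSum c‖ ^ 2 ≤ 3 * (p : ℝ) ^ 2 := by
  have hp := (Fact.out : p.Prime)
  have h : ∑ c : ZMod p, ‖cubicSum c‖ ^ 2
      = ∑ a : (ZMod p)ˣ, ∑ b : (ZMod p)ˣ,
        if (b : ZMod p) ^ 3 = (a : ZMod p) ^ 3 then (p : ℝ) else 0 := by
    rw [← Complex.ofReal_inj, Complex.ofReal_sum]
    simp_rw [cubicSum, norm_sq_sum_eq]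
    rw [Finset.sum_comm]
    push_cast
    refine Finset.sum_congr rfl fun a _ => ?_
    rw [Finset.sum_comm]
    refine Finset.sum_congr rfl fun b _ => ?_
    have h1 := AddChar.sum_mulShift ((a : ZMod p) ^ 3 - (b : ZMod p) ^ 3)
      (ZMod.isPrimitive_stdAddChar p)
    rw [ZMod.card] at h1
    simp_rw [← AddChar.map_neg_eq_conj, ← AddChar.map_add_eq_mul]
    rw [Finset.sum_congr rfl fun c _ => by
      rw [show c * (a : ZMod p) ^ 3 + -(c * (b : ZMod p) ^ 3)
        = c * ((a : ZMod p) ^ 3 - (b : ZMod p) ^ 3) by ring], h1]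
    simp only [sub_eq_zero, eq_comm (a := (a : ZMod p) ^ 3)]
    split_ifs <;> simp
  rw [h]
  calc _ ≤ ∑ a : (ZMod p)ˣ, 3 * (p : ℝ) := by
        refine Finset.sum_le_sum fun a _ => ?_
        rw [← Finset.sum_filter, Finset.sum_const, nsmul_eq_mul]
        gcongr
        exact Nat.cast_le_ofNat.2 (card_filter_cube_eq_le ((a : ZMod p) ^ 3))
    _ = ((p : ℝ) - 1) * (3 * p) := by
        rw [Finset.sum_const, nsmul_eq_mul, Finset.card_univ, card_units_eq]
    _ ≤ _ := by nlinarith [(Nat.cast_nonneg p : (0 : ℝ) ≤ p)]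

/-- An elementary substitute for the Weil bound. The sum is constant along `c t³`, so averaging over
`t`, with each value hit at most three times, gives `(p - 1) ‖cubicSum c‖² ≤ 9 p²`; then `p - 1 ≥ p
/ 2` yields 18. -/
theorem norm_cubicSum_sq_le {c : ZMod p} (hc : c ≠ 0) : ‖cubicSum c‖ ^ 2 ≤ 18 * p := by
  have hp := (Fact.out : p.Prime)
  have hp2 : (2 : ℝ) ≤ p := by exact_mod_cast hp.two_le
  have h1 : ((p : ℝ) - 1) * ‖cubicSum c‖ ^ 2
      = ∑ t : (ZMod p)ˣ, ‖cubicSum (c * (t : ZMod p) ^ 3)‖ ^ 2 := by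
    simp_rw [cubicSum_mul_cube]
    rw [Finset.sum_const, nsmul_eq_mul, Finset.card_univ, card_units_eq]
  have h2 : ∑ t : (ZMod p)ˣ, ‖cubicSum (c * (t : ZMod p) ^ 3)‖ ^ 2
      ≤ 3 * ∑ m : ZMod p, ‖cubicSum m‖ ^ 2 := by
    rw [← Finset.sum_fiberwise Finset.univ (fun t : (ZMod p)ˣ => c * (t : ZMod p) ^ 3),
      Finset.mul_sum]
    refine Finset.sum_le_sum fun m _ => ?_
    rw [Finset.sum_congr rfl (g := fun _ => ‖cubicSum m‖ ^ 2) fun t ht => by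
      rw [(Finset.mem_filter.1 ht).2], Finset.sum_const, nsmul_eq_mul]
    gcongr
    have h3 : (Finset.univ.filter fun t : (ZMod p)ˣ => c * (t : ZMod p) ^ 3 = m)
        = Finset.univ.filter fun t : (ZMod p)ˣ => (t : ZMod p) ^ 3 = c⁻¹ * m := by
      ext t
      simp only [Finset.mem_filter, Finset.mem_univ, true_and]
      rw [eq_inv_mul_iff_mul_eq₀ hc]
    rw [h3]
    exact_mod_cast card_filter_cube_eq_le _
  have h3 := sum_norm_cubicSum_sq_le (p := p)
  have h4 : ((p : ℝ) - 1) * ‖cubicSum c‖ ^ 2 ≤ 9 * (p : ℝ) ^ 2 := by linarith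
  by_contra! hlt
  nlinarith

theorem norm_cubicSum_le {c : ZMod p} (hc : c ≠ 0) : ‖cubicSum c‖ ≤ 5 * √p := by
  refine le_of_sq_le_sq ?_ (by positivity)
  rw [mul_pow, Real.sq_sqrt (Nat.cast_nonneg p)]
  have := norm_cubicSum_sq_le hc
  have h0 : (0 : ℝ) ≤ p := Nat.cast_nonneg p
  linarith

theorem norm_cubicSum_sq_le_add (c : ZMod p) :
    ‖cubicSum c‖ ^ 2 ≤ 18 * p + if c = 0 then (p : ℝ) ^ 2 else 0 := by
  have hp := (Fact.out : p.Prime)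
  have hp2 : (2 : ℝ) ≤ p := by exact_mod_cast hp.two_le
  split_ifs with hc
  · have h : ‖cubicSum c‖ = (p : ℝ) - 1 := by
      rw [hc, cubicSum_zero, show (p : ℂ) - 1 = ((p - 1 : ℝ) : ℂ) by push_cast; rfl,
        Complex.norm_real, Real.norm_of_nonneg (by linarith)]
    rw [h]
    nlinarith
  · simpa using norm_cubicSum_sq_le hc

/-! ### Moments of the weighted cubic sums -/

theorem sum_units_val {M : Type*} [AddCommMonoid M] (f : ℕ → M) :
    ∑ u : (ZMod p)ˣ, f (u : ZMod p).val = ∑ n ∈ Finset.Icc 1 (p - 1), f n := by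
  have hp := (Fact.out : p.Prime)
  refine Finset.sum_bij (fun u _ => (u : ZMod p).val) (fun u _ => ?_) (fun u _ v _ h => ?_)
    (fun n hn => ?_) fun _ _ => rfl
  · have h1 := ZMod.val_lt (u : ZMod p)
    have h2 : (u : ZMod p).val ≠ 0 := by
      rw [Ne, ZMod.val_eq_zero]
      exact u.ne_zero
    rw [Finset.mem_Icc]
    omega
  · exact Units.ext (ZMod.val_injective p h)
  · rw [Finset.mem_Icc] at hn
    have hlt : n < p := by have := hp.pos; omega
    have h0 : (n : ZMod p) ≠ 0 := by
      rw [Ne, ZMod.natCast_eq_zero_iff]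
      exact Nat.not_dvd_of_pos_of_lt hn.1 hlt
    exact ⟨Units.mk0 _ h0, Finset.mem_univ _, ZMod.val_cast_of_lt hlt⟩

theorem kummerSum_eq_sum_units (n : ℤ) (χ : DirichletCharacter ℂ p) :
    kummerSum p n χ = ∑ u : (ZMod p)ˣ,
      χ (u : ZMod p) * ZMod.stdAddChar ((n : ZMod p) * (u : ZMod p) ^ 3) := by
  have hp := (Fact.out : p.Prime)
  have hterm : ∀ a : ℕ, eAdd ((n : ℝ) * (a : ℝ) ^ 3 / (p : ℝ))
      = ZMod.stdAddChar ((n : ZMod p) * (a : ZMod p) ^ 3) := by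
    intro a
    have h := ZMod.stdAddChar_coe (N := p) (n * (a : ℤ) ^ 3)
    push_cast at h
    rw [h, eAdd]
    push_cast
    ring_nf
  have hu := sum_units_val (p := p) fun a : ℕ => χ (a : ZMod p)
    * ZMod.stdAddChar ((n : ZMod p) * (a : ZMod p) ^ 3)
  simp only [ZMod.natCast_zmod_val] at hu
  rw [hu, kummerSum]
  simp_rw [hterm]
  -- The last index `a = p` drops out because `χ(p) = 0`.
  obtain ⟨q, rfl⟩ : ∃ q, p = q + 1 := ⟨p - 1, by have := hp.pos; omega⟩
  rw [Finset.sum_Icc_succ_top (by omega), CharP.cast_eq_zero (ZMod (q + 1)) (q + 1),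
    χ.map_zero, zero_mul, add_zero, Nat.add_sub_cancel]

/-- Substituting `a = u b` in the double sum exhibits `|kummerSum|²` as a character sum in `u`, so
that Parseval also computes the fourth moment. -/
theorem norm_kummerSum_sq (n : ℤ) (χ : DirichletCharacter ℂ p) :
    ((‖kummerSum p n χ‖ ^ 2 : ℝ) : ℂ) = ∑ u : (ZMod p)ˣ,
      χ (u : ZMod p) * cubicSum ((n : ZMod p) * ((u : ZMod p) ^ 3 - 1)) := by
  rw [kummerSum_eq_sum_units, norm_sq_sum_eq, Finset.sum_comm]
  simp_rw [cubicSum, Finset.mul_sum]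
  rw [Finset.sum_comm (s := (Finset.univ : Finset (ZMod p)ˣ))]
  rw [Finset.sum_comm]
  nth_rewrite 2 [Finset.sum_comm]
  refine Finset.sum_congr rfl fun b _ => ?_
  refine (Fintype.sum_equiv (Equiv.mulRight b) _ _ fun u => ?_).symm
  rw [Equiv.coe_mulRight, Units.val_mul, map_mul χ, map_mul (starRingEnd ℂ),
    ← AddChar.map_neg_eq_conj, starRingEnd_apply, MulChar.star_apply', MulChar.inv_apply']
  have h1 : χ (b : ZMod p) * χ ((b : ZMod p)⁻¹) = 1 := by
    rw [← map_mul, mul_inv_cancel₀ b.ne_zero, map_one]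
  rw [show χ (u : ZMod p) * χ (b : ZMod p)
      * ZMod.stdAddChar ((n : ZMod p) * ((u : ZMod p) * (b : ZMod p)) ^ 3)
      * (χ ((b : ZMod p)⁻¹) * ZMod.stdAddChar (-((n : ZMod p) * (b : ZMod p) ^ 3)))
    = χ (u : ZMod p) * (χ (b : ZMod p) * χ ((b : ZMod p)⁻¹))
      * (ZMod.stdAddChar ((n : ZMod p) * ((u : ZMod p) * (b : ZMod p)) ^ 3)
      * ZMod.stdAddChar (-((n : ZMod p) * (b : ZMod p) ^ 3))) by ring, h1, mul_one,
    ← AddChar.map_add_eq_mul]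
  ring_nf

theorem sum_norm_kummerSum_sq_le (n : ℤ) :
    ∑ χ : DirichletCharacter ℂ p, ‖kummerSum p n χ‖ ^ 2 ≤ (p : ℝ) ^ 2 := by
  have hp1 : (1 : ℝ) ≤ p := by exact_mod_cast (Fact.out : p.Prime).one_le
  simp_rw [kummerSum_eq_sum_units]
  rw [sum_norm_sq_sum_units]
  simp only [AddChar.norm_apply, one_pow, Finset.sum_const, Finset.card_univ, nsmul_eq_mul,
    card_units_eq, mul_one]
  nlinarith

theorem sum_norm_kummerSum_pow_four_le {n : ℤ} (hn : (n : ZMod p) ≠ 0) :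
    ∑ χ : DirichletCharacter ℂ p, (‖kummerSum p n χ‖ ^ 2) ^ 2 ≤ 21 * (p : ℝ) ^ 3 := by
  have hp1 : (1 : ℝ) ≤ p := by exact_mod_cast (Fact.out : p.Prime).one_le
  have h : ∀ χ : DirichletCharacter ℂ p, (‖kummerSum p n χ‖ ^ 2) ^ 2
      = ‖∑ u : (ZMod p)ˣ,
      χ (u : ZMod p) * cubicSum ((n : ZMod p) * ((u : ZMod p) ^ 3 - 1))‖ ^ 2 := by
    intro χ
    rw [← norm_kummerSum_sq, Complex.norm_real, Real.norm_of_nonneg (by positivity)]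
  rw [Finset.sum_congr rfl fun χ _ => h χ, sum_norm_sq_sum_units]
  -- The generic bound `18 p` over `p - 1` units, plus `p²` for each of the at most three `u` with
  -- `u³ = 1`.
  have h2 : ∑ u : (ZMod p)ˣ, ‖cubicSum ((n : ZMod p) * ((u : ZMod p) ^ 3 - 1))‖ ^ 2
      ≤ 21 * (p : ℝ) ^ 2 := by
    refine (Finset.sum_le_sum fun u _ => norm_cubicSum_sq_le_add _).trans ?_
    rw [Finset.sum_add_distrib, Finset.sum_const, nsmul_eq_mul, Finset.card_univ, card_units_eq,
      ← Finset.sum_filter, Finset.sum_const, nsmul_eq_mul]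
    simp only [mul_eq_zero, hn, false_or, sub_eq_zero]
    have h3 : (((Finset.univ.filter fun t : (ZMod p)ˣ => (t : ZMod p) ^ 3 = 1).card : ℕ) : ℝ)
        ≤ 3 := by exact_mod_cast card_filter_cube_eq_le (1 : ZMod p)
    nlinarith [mul_le_mul_of_nonneg_right h3 (sq_nonneg (p : ℝ))]
  calc _ ≤ (p : ℝ) * (21 * (p : ℝ) ^ 2) := by
        gcongr
        linarith
    _ = _ := by ring

theorem kummerSum_one (n : ℤ) : kummerSum p n 1 = cubicSum (n : ZMod p) := by
  rw [kummerSum_eq_sum_units, cubicSum]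
  simp

/-- Second moment of the cubic sums weighted by the square of a real Dirichlet polynomial. -/
theorem sum_norm_kummerSum_mul_sq (n : ℤ) (w : (ZMod p)ˣ → ℝ) :
    ((∑ χ : DirichletCharacter ℂ p,
      ‖kummerSum p n χ * ∑ v : (ZMod p)ˣ, χ (v : ZMod p) * w v‖ ^ 2 : ℝ) : ℂ)
      = ((p : ℂ) - 1) * ∑ v : (ZMod p)ˣ, ∑ v' : (ZMod p)ˣ, (w v : ℂ) * w v'
        * cubicSum ((n : ZMod p) * (((v : ZMod p)⁻¹) ^ 3 - ((v' : ZMod p)⁻¹) ^ 3)) := by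
  -- With `x = u v` the product becomes a single character sum, to which Parseval applies.
  have h : ∀ χ : DirichletCharacter ℂ p,
      kummerSum p n χ * ∑ v : (ZMod p)ˣ, χ (v : ZMod p) * w v
      = ∑ x : (ZMod p)ˣ, χ (x : ZMod p) * ∑ v : (ZMod p)ˣ,
        (w v : ℂ) * ZMod.stdAddChar ((n : ZMod p) * ((x : ZMod p) * (v : ZMod p)⁻¹) ^ 3) := by
    intro χ
    rw [kummerSum_eq_sum_units, Finset.sum_mul_sum, Finset.sum_comm]
    simp_rw [Finset.mul_sum]
    rw [Finset.sum_comm (f := fun x v : (ZMod p)ˣ => χ (x : ZMod p) * ((w v : ℂ)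
      * ZMod.stdAddChar ((n : ZMod p) * ((x : ZMod p) * (v : ZMod p)⁻¹) ^ 3)))]
    refine Finset.sum_congr rfl fun v _ => ?_
    refine Fintype.sum_equiv (Equiv.mulRight v) _ _ fun u => ?_
    rw [Equiv.coe_mulRight, Units.val_mul, map_mul χ, mul_inv_cancel_right₀ v.ne_zero]
    ring
  rw [Finset.sum_congr rfl fun χ _ => by rw [h χ], sum_norm_sq_sum_units]
  push_cast
  congr 1
  simp_rw [← Complex.ofReal_pow, norm_sq_sum_eq]
  rw [Finset.sum_comm]
  refine Finset.sum_congr rfl fun v _ => ?_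
  rw [Finset.sum_comm]
  refine Finset.sum_congr rfl fun v' _ => ?_
  rw [cubicSum, Finset.mul_sum]
  refine Finset.sum_congr rfl fun x _ => ?_
  rw [map_mul (starRingEnd ℂ), Complex.conj_ofReal, ← AddChar.map_neg_eq_conj,
    show (w v : ℂ) * ZMod.stdAddChar ((n : ZMod p) * ((x : ZMod p) * (v : ZMod p)⁻¹) ^ 3)
      * (w v' * ZMod.stdAddChar (-((n : ZMod p) * ((x : ZMod p) * (v' : ZMod p)⁻¹) ^ 3)))
    = w v * w v' * (ZMod.stdAddChar ((n : ZMod p) * ((x : ZMod p) * (v : ZMod p)⁻¹) ^ 3)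
      * ZMod.stdAddChar (-((n : ZMod p) * ((x : ZMod p) * (v' : ZMod p)⁻¹) ^ 3))) by ring,
    ← AddChar.map_add_eq_mul]
  ring_nf

/-- Group the terms by residue class. The coefficients vanish below `p`, so the surviving `k` in a
class have distinct quotients `k / p` in `[1, p]`, and `k ≥ p (k / p)` bounds the class weight by
`(1 + log p) / p`. Parseval finishes. -/
theorem sum_norm_sq_dirichletPolynomial_le {b : ℕ → ℝ} (hb0 : ∀ k, 0 ≤ b k)
    (hb1 : ∀ k, b k ≤ 1) (hb : ∀ k, k ≠ 0 → k < p → b k = 0) :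
    ∑ χ : DirichletCharacter ℂ p,
      ‖∑ k ∈ Finset.Icc 1 (p ^ 2), (b k : ℂ) * (χ (k : ZMod p) / k)‖ ^ 2
      ≤ (1 + Real.log p) ^ 2 := by
  have hp := (Fact.out : p.Prime)
  have hp1 : (1 : ℝ) ≤ p := by exact_mod_cast hp.one_le
  set F : (ZMod p)ˣ → ℝ := fun u => ∑ k ∈ (Finset.Icc 1 (p ^ 2)).filter
    (fun k : ℕ => (k : ZMod p) = u), b k / k
    with hF
  have hsum : ∀ χ : DirichletCharacter ℂ p,
      ∑ k ∈ Finset.Icc 1 (p ^ 2), (b k : ℂ) * (χ (k : ZMod p) / k)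
      = ∑ u : (ZMod p)ˣ, χ (u : ZMod p) * (F u : ℂ) := by
    intro χ
    simp only [hF]
    push_cast
    simp_rw [Finset.mul_sum, Finset.sum_filter]
    rw [Finset.sum_comm]
    refine Finset.sum_congr rfl fun k _ => ?_
    by_cases hk : IsUnit (k : ZMod p)
    · obtain ⟨u, hu⟩ := hk
      rw [Finset.sum_eq_single u]
      · rw [← hu, if_pos rfl]
        ring
      · intro v _ hvu
        rw [← hu, if_neg fun h => hvu (Units.ext h).symm]
      · simp
    · rw [χ.map_nonunit hk, Finset.sum_eq_zero]
      · simp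
      · intro v _
        rw [if_neg]
        rintro h
        exact hk (h ▸ v.isUnit)
  have hFle : ∀ u, F u ≤ (1 + Real.log p) / p := by
    intro u
    have h1 : F u ≤ ∑ k ∈ (Finset.Icc 1 (p ^ 2)).filter
        (fun k : ℕ => (k : ZMod p) = u ∧ p ≤ k), 1 / (((k / p : ℕ) : ℝ) * p) := by
      rw [← Finset.filter_filter, Finset.sum_filter (fun k : ℕ => p ≤ k)]
      simp only [hF]
      refine Finset.sum_le_sum fun k hk => ?_
      have hk1 := (Finset.mem_Icc.1 (Finset.mem_filter.1 hk).1).1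
      split_ifs with hpk
      · have h0 : 0 < k / p := Nat.div_pos hpk hp.pos
        have h2 : (((k / p : ℕ) : ℝ) * p) ≤ k := by exact_mod_cast Nat.div_mul_le_self k p
        have h3 : (0 : ℝ) < ((k / p : ℕ) : ℝ) := by exact_mod_cast h0
        gcongr
        exact hb1 k
      · rw [hb k (by omega) (by omega), zero_div]
    refine h1.trans ?_
    rw [← Finset.sum_image (s := (Finset.Icc 1 (p ^ 2)).filter
        (fun k : ℕ => (k : ZMod p) = u ∧ p ≤ k)) (g := fun k => k / p)
        (f := fun q : ℕ => 1 / ((q : ℝ) * p))]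
    · have hsub : ((Finset.Icc 1 (p ^ 2)).filter
          (fun k : ℕ => (k : ZMod p) = u ∧ p ≤ k)).image (fun k => k / p) ⊆ Finset.Icc 1 p := by
        intro q hq
        obtain ⟨k, hk, rfl⟩ := Finset.mem_image.1 hq
        simp only [Finset.mem_filter, Finset.mem_Icc] at hk ⊢
        refine ⟨Nat.div_pos hk.2.2 hp.pos, ?_⟩
        refine Nat.div_le_of_le_mul ?_
        rw [← sq]
        exact hk.1.2
      refine (Finset.sum_le_sum_of_subset_of_nonneg hsub fun _ _ _ => by positivity).trans ?_
      simp_rw [← div_div]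
      rw [← Finset.sum_div]
      gcongr
      exact sum_Icc_one_div_le p
    · intro k hk l hl hkl
      simp only [Finset.coe_filter, Finset.mem_Icc, Set.mem_ofPred_eq] at hk hl
      have hmod : k % p = l % p := by
        have : (k : ZMod p) = (l : ZMod p) := by rw [hk.2.1, hl.2.1]
        exact (ZMod.natCast_eq_natCast_iff' k l p).1 this
      rw [← Nat.div_add_mod k p, ← Nat.div_add_mod l p, hmod, show k / p = l / p from hkl]
  rw [Finset.sum_congr rfl fun χ _ => by rw [hsum χ], sum_norm_sq_sum_units]
  have hlog : 0 ≤ Real.log p := Real.log_nonneg hp1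
  calc ((p : ℝ) - 1) * ∑ u : (ZMod p)ˣ, ‖(F u : ℂ)‖ ^ 2
      ≤ ((p : ℝ) - 1) * ∑ u : (ZMod p)ˣ, ((1 + Real.log p) / p) ^ 2 := by
        refine mul_le_mul_of_nonneg_left (Finset.sum_le_sum fun u _ => ?_) (by linarith)
        have hF0 : 0 ≤ F u := Finset.sum_nonneg fun k _ => div_nonneg (hb0 k) (Nat.cast_nonneg k)
        rw [Complex.norm_real, Real.norm_of_nonneg hF0]
        exact pow_le_pow_left₀ hF0 (hFle u) 2
    _ = (((p : ℝ) - 1) / p) ^ 2 * (1 + Real.log p) ^ 2 := by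
        rw [Finset.sum_const, nsmul_eq_mul, Finset.card_univ, card_units_eq]
        ring
    _ ≤ 1 * (1 + Real.log p) ^ 2 := by
        gcongr
        refine pow_le_one₀ (div_nonneg (by linarith) (by linarith)) ?_
        rw [div_le_one (by linarith)]
        linarith
    _ = _ := one_mul _

end CubicSums

/-! ### Comparison with the main term -/

section MainTerm

variable {p : ℕ} [Fact p.Prime]

/-- The truncation at `p - 1` of the Dirichlet series of `r χ` at `1`. -/
noncomputable def rPoly (χ : DirichletCharacter ℂ p) : ℂ :=
  ∑ n ∈ Finset.Icc 1 (p - 1), (rMul n : ℂ) * (χ (n : ZMod p) / n)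

/-- The weight `r(v) / v` at the least positive residue of `v`. -/
noncomputable def rWeight (v : (ZMod p)ˣ) : ℝ := rMul (v : ZMod p).val / (v : ZMod p).val

theorem rWeight_nonneg (v : (ZMod p)ˣ) : 0 ≤ rWeight v :=
  div_nonneg (rMul_nonneg _) (Nat.cast_nonneg _)

theorem rWeight_le (v : (ZMod p)ˣ) : rWeight v ≤ 1 / ((v : ZMod p).val : ℝ) :=
  div_le_div_of_nonneg_right (rMul_le_one _) (Nat.cast_nonneg _)

theorem rPoly_eq_sum_units (χ : DirichletCharacter ℂ p) :
    rPoly χ = ∑ v : (ZMod p)ˣ, χ (v : ZMod p) * (rWeight v : ℂ) := by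
  rw [rPoly, ← sum_units_val fun n : ℕ => (rMul n : ℂ) * (χ (n : ZMod p) / n)]
  refine Finset.sum_congr rfl fun v _ => ?_
  rw [rWeight, ZMod.natCast_zmod_val]
  push_cast
  ring

theorem sum_rWeight_sq_le : (∑ v : (ZMod p)ˣ, rWeight v) ^ 2 ≤ 1 + 2 * Real.log p := by
  have hp := (Fact.out : p.Prime)
  have h := sum_units_val (p := p) fun n : ℕ => rMul n / (n : ℝ)
  have h1 : (0 : ℝ) < ((p - 1 : ℕ) : ℝ) := by exact_mod_cast (by have := hp.two_le; omega)
  have h2 : ((p - 1 : ℕ) : ℝ) ≤ p := by exact_mod_cast Nat.sub_le p 1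
  have h3 := Real.log_le_log h1 h2
  have h4 := sum_rMul_div_sq_le (p - 1)
  simp only [rWeight, h]
  linarith

/-- The coefficients `1 - rConv (p - 1) k` vanish for `1 ≤ k < p`, which prepares the second-moment
bound for polynomials supported beyond `p`. -/
theorem norm_LFunction_sub_norm_rPoly_sq_le {χ : DirichletCharacter ℂ p} (hχ : χ ≠ 1) :
    |‖DirichletCharacter.LFunction χ 1‖ - ‖rPoly χ‖ ^ 2|
      ≤ ‖∑ k ∈ Finset.Icc 1 (p ^ 2), ((1 - rConv (p - 1) k : ℝ) : ℂ) * (χ (k : ZMod p) / k)‖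
        + 1 / p := by
  have hsq : rPoly χ ^ 2
      = ∑ k ∈ Finset.Icc 1 (p ^ 2), (rConv (p - 1) k : ℂ) * (χ (k : ZMod p) / k) := by
    have h := sum_rMul_mul_sum_rMul (R := ℂ) (p - 1) (p ^ 2)
      (Nat.pow_le_pow_left (Nat.sub_le p 1) 2) (fun n => χ (n : ZMod p) / n) fun a b => by
        push_cast
        rw [map_mul, div_mul_div_comm]
    simp only [Complex.coe_algebraMap] at h
    exact h
  have hdecomp : DirichletCharacter.LFunction χ 1 - rPoly χ ^ 2
      = (∑ k ∈ Finset.Icc 1 (p ^ 2), ((1 - rConv (p - 1) k : ℝ) : ℂ) * (χ (k : ZMod p) / k))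
        + (DirichletCharacter.LFunction χ 1
          - ∑ k ∈ Finset.Icc 1 (p ^ 2), χ (k : ZMod p) / (k : ℂ)) := by
    rw [hsq]
    simp only [Complex.ofReal_sub, Complex.ofReal_one, sub_mul, one_mul, Finset.sum_sub_distrib]
    ring
  rw [← norm_pow]
  refine (abs_norm_sub_norm_le _ _).trans ?_
  rw [hdecomp]
  exact (norm_add_le _ _).trans (add_le_add_right (norm_LFunction_sub_sum_le hχ) _)

theorem abs_sum_kummerSum_LFunction_sub_le {n : ℤ} (hn : (n : ZMod p) ≠ 0) :
    |(∑ χ : DirichletCharacter ℂ p with χ ≠ 1,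
        ‖kummerSum p n χ‖ ^ 2 * ‖DirichletCharacter.LFunction χ 1‖)
      - ∑ χ : DirichletCharacter ℂ p with χ ≠ 1, ‖kummerSum p n χ‖ ^ 2 * ‖rPoly χ‖ ^ 2|
      ≤ √(21 * (p : ℝ) ^ 3) * (1 + Real.log p) + p := by
  have hp := (Fact.out : p.Prime)
  have hp0 : (0 : ℝ) < p := by exact_mod_cast hp.pos
  have hlog : 0 ≤ Real.log p := Real.log_nonneg (by exact_mod_cast hp.one_le)
  set E : DirichletCharacter ℂ p → ℝ := fun χ =>
    ‖∑ k ∈ Finset.Icc 1 (p ^ 2), ((1 - rConv (p - 1) k : ℝ) : ℂ) * (χ (k : ZMod p) / k)‖ with hE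
  rw [← Finset.sum_sub_distrib]
  calc _ ≤ ∑ χ : DirichletCharacter ℂ p with χ ≠ 1,
        (‖kummerSum p n χ‖ ^ 2 * E χ + ‖kummerSum p n χ‖ ^ 2 * (1 / p)) := by
        refine (Finset.abs_sum_le_sum_abs _ _).trans (Finset.sum_le_sum fun χ hχ => ?_)
        rw [← mul_sub, abs_mul, abs_of_nonneg (by positivity), ← mul_add]
        exact mul_le_mul_of_nonneg_left
          (norm_LFunction_sub_norm_rPoly_sq_le (Finset.mem_filter.1 hχ).2) (by positivity)
    _ ≤ ∑ χ : DirichletCharacter ℂ p,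
        (‖kummerSum p n χ‖ ^ 2 * E χ + ‖kummerSum p n χ‖ ^ 2 * (1 / p)) :=
        Finset.sum_le_sum_of_subset_of_nonneg (Finset.filter_subset _ _)
          fun χ _ _ => by positivity
    _ ≤ √(∑ χ : DirichletCharacter ℂ p, (‖kummerSum p n χ‖ ^ 2) ^ 2)
          * √(∑ χ : DirichletCharacter ℂ p, E χ ^ 2)
        + (∑ χ : DirichletCharacter ℂ p, ‖kummerSum p n χ‖ ^ 2) * (1 / p) := by
        rw [Finset.sum_add_distrib, ← Finset.sum_mul]
        exact add_le_add_left (Real.sum_mul_le_sqrt_mul_sqrt _ _ _) _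
    _ ≤ √(21 * (p : ℝ) ^ 3) * √((1 + Real.log p) ^ 2) + (p : ℝ) ^ 2 * (1 / p) := by
        gcongr
        · exact sum_norm_kummerSum_pow_four_le hn
        · refine sum_norm_sq_dirichletPolynomial_le
            (fun k => sub_nonneg.2 (rConv_le_one _ _))
            (fun k => sub_le_self _ (rConv_nonneg _ _)) fun k hk hkp => ?_
          rw [rConv_eq_one hk (by omega), sub_self]
        · exact sum_norm_kummerSum_sq_le n
    _ = _ := by
        rw [Real.sqrt_sq (by linarith)]
        field_simp

/-- Factoring `m³ - n³` shows that `p` divides the positive integer `m² + m n + n²`, which is at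
most `(m + n)²`. -/
theorem sqrt_le_add_of_cube_eq {m n : ℕ} (hm : 0 < m) (hne : (m : ZMod p) ≠ n)
    (h : (m : ZMod p) ^ 3 = (n : ZMod p) ^ 3) : √(p : ℝ) ≤ m + n := by
  have h1 : ((m ^ 2 + m * n + n ^ 2 : ℕ) : ZMod p) = 0 := by
    have h2 : ((m : ZMod p) - n) * ((m ^ 2 + m * n + n ^ 2 : ℕ) : ZMod p) = 0 := by
      push_cast
      linear_combination h
    exact (mul_eq_zero.1 h2).resolve_left (sub_ne_zero.2 hne)
  have h3 := Nat.le_of_dvd (by positivity) ((ZMod.natCast_eq_zero_iff _ _).1 h1)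
  refine Real.sqrt_le_iff.2 ⟨by positivity, ?_⟩
  have h4 : (p : ℝ) ≤ (m : ℝ) ^ 2 + m * n + (n : ℝ) ^ 2 := by exact_mod_cast h3
  nlinarith [mul_nonneg (Nat.cast_nonneg m : (0 : ℝ) ≤ m) (Nat.cast_nonneg n : (0 : ℝ) ≤ n)]

theorem val_units_pos (v : (ZMod p)ˣ) : 0 < (v : ZMod p).val :=
  Nat.pos_of_ne_zero fun h => v.ne_zero ((ZMod.val_eq_zero _).1 h)

/-- One factor `√p` of `p` is traded for `v + v'`, and `(v + v') / (v v')` splits into reciprocals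
whose sum is only logarithmic. -/
theorem rWeight_mul_rWeight_le {v v' : (ZMod p)ˣ} (hne : v ≠ v')
    (h : (v : ZMod p) ^ 3 = (v' : ZMod p) ^ 3) :
    rWeight v * rWeight v' * p
      ≤ √p * (1 / ((v : ZMod p).val : ℝ) + 1 / ((v' : ZMod p).val : ℝ)) := by
  have h1 := sqrt_le_add_of_cube_eq (p := p) (m := (v : ZMod p).val) (n := (v' : ZMod p).val)
    (val_units_pos v) (by simpa [Units.val_inj] using hne) (by simpa using h)
  have hm : (0 : ℝ) < (v : ZMod p).val := by exact_mod_cast val_units_pos v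
  have hn : (0 : ℝ) < (v' : ZMod p).val := by exact_mod_cast val_units_pos v'
  have hs : √(p : ℝ) * √p = p := Real.mul_self_sqrt (Nat.cast_nonneg p)
  calc rWeight v * rWeight v' * p
      ≤ (1 / ((v : ZMod p).val : ℝ)) * (1 / ((v' : ZMod p).val : ℝ)) * p := by
        gcongr
        · exact rWeight_nonneg v'
        · exact rWeight_le v
        · exact rWeight_le v'
    _ = √p * (√p * ((1 / ((v : ZMod p).val : ℝ)) * (1 / ((v' : ZMod p).val : ℝ)))) := by
        rw [← mul_assoc, hs, mul_comm]
    _ ≤ √p * (((v : ZMod p).val + (v' : ZMod p).val)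
          * ((1 / ((v : ZMod p).val : ℝ)) * (1 / ((v' : ZMod p).val : ℝ)))) := by gcongr
    _ = _ := by
        field_simp
        ring

theorem sum_one_div_val_cube_eq_le :
    ∑ v : (ZMod p)ˣ, ∑ v' : (ZMod p)ˣ, (if (v' : ZMod p) ^ 3 = (v : ZMod p) ^ 3
      then 1 / ((v : ZMod p).val : ℝ) + 1 / ((v' : ZMod p).val : ℝ) else 0)
      ≤ 6 * (1 + Real.log p) := by
  have hp := (Fact.out : p.Prime)
  have hhalf : ∑ v : (ZMod p)ˣ, ∑ v' : (ZMod p)ˣ, (if (v' : ZMod p) ^ 3 = (v : ZMod p) ^ 3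
      then 1 / ((v : ZMod p).val : ℝ) else 0) ≤ 3 * (1 + Real.log p) := by
    calc _ ≤ ∑ v : (ZMod p)ˣ, 3 * (1 / ((v : ZMod p).val : ℝ)) := by
          refine Finset.sum_le_sum fun v _ => ?_
          rw [← Finset.sum_filter, Finset.sum_const, nsmul_eq_mul]
          gcongr
          exact Nat.cast_le_ofNat.2 (card_filter_cube_eq_le ((v : ZMod p) ^ 3))
      _ ≤ 3 * (1 + Real.log p) := by
          rw [← Finset.mul_sum, sum_units_val fun n : ℕ => 1 / (n : ℝ)]
          have h1 : (0 : ℝ) < ((p - 1 : ℕ) : ℝ) := by exact_mod_cast (by have := hp.two_le; omega)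
          have h2 : ((p - 1 : ℕ) : ℝ) ≤ p := by exact_mod_cast Nat.sub_le p 1
          have h3 := Real.log_le_log h1 h2
          have h4 := sum_Icc_one_div_le (p - 1)
          linarith
  have hsplit : ∀ v v' : (ZMod p)ˣ, (if (v' : ZMod p) ^ 3 = (v : ZMod p) ^ 3
      then 1 / ((v : ZMod p).val : ℝ) + 1 / ((v' : ZMod p).val : ℝ) else 0)
      = (if (v' : ZMod p) ^ 3 = (v : ZMod p) ^ 3 then 1 / ((v : ZMod p).val : ℝ) else 0)
        + (if (v : ZMod p) ^ 3 = (v' : ZMod p) ^ 3 then 1 / ((v' : ZMod p).val : ℝ) else 0) := by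
    intro v v'
    by_cases h : (v' : ZMod p) ^ 3 = (v : ZMod p) ^ 3
    · rw [if_pos h, if_pos h, if_pos h.symm]
    · rw [if_neg h, if_neg h, if_neg fun h' => h h'.symm, add_zero]
  simp_rw [hsplit, Finset.sum_add_distrib]
  rw [Finset.sum_comm (f := fun v v' : (ZMod p)ˣ => if (v : ZMod p) ^ 3 = (v' : ZMod p) ^ 3
    then 1 / ((v' : ZMod p).val : ℝ) else 0)]
  linarith

/-- On the diagonal the difference is zero. Elsewhere, distinct cubes give square-root cancellation
(first term), while equal cubes give a full-size sum with small weights (second term). -/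
theorem norm_cubicSum_sub_diagonal_le {n : ℤ} (hn : (n : ZMod p) ≠ 0) (v v' : (ZMod p)ˣ) :
    ‖(rWeight v : ℂ) * rWeight v'
        * cubicSum ((n : ZMod p) * (((v : ZMod p)⁻¹) ^ 3 - ((v' : ZMod p)⁻¹) ^ 3))
      - if v = v' then ((p : ℂ) - 1) * (rWeight v : ℂ) ^ 2 else 0‖
      ≤ 5 * √p * (rWeight v * rWeight v')
        + √p * (if (v' : ZMod p) ^ 3 = (v : ZMod p) ^ 3
          then 1 / ((v : ZMod p).val : ℝ) + 1 / ((v' : ZMod p).val : ℝ) else 0) := by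
  have hp1 : (1 : ℝ) ≤ p := by exact_mod_cast (Fact.out : p.Prime).one_le
  have hw := rWeight_nonneg v
  have hw' := rWeight_nonneg v'
  have hnorm : ∀ c : ZMod p, ‖(rWeight v : ℂ) * rWeight v' * cubicSum c‖
      = rWeight v * rWeight v' * ‖cubicSum c‖ := by
    intro c
    rw [norm_mul, norm_mul, Complex.norm_real, Complex.norm_real, Real.norm_of_nonneg hw,
      Real.norm_of_nonneg hw']
  rcases eq_or_ne v v' with rfl | hne
  · rw [if_pos rfl, sub_self, mul_zero, cubicSum_zero,
      show (rWeight v : ℂ) * rWeight v * ((p : ℂ) - 1) - ((p : ℂ) - 1) * (rWeight v : ℂ) ^ 2 = 0 by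
        ring, norm_zero]
    split_ifs <;> positivity
  · rw [if_neg hne, sub_zero, hnorm]
    by_cases h : (v' : ZMod p) ^ 3 = (v : ZMod p) ^ 3
    · rw [if_pos h, inv_pow, inv_pow, h, sub_self, mul_zero, cubicSum_zero,
        show (p : ℂ) - 1 = ((p - 1 : ℝ) : ℂ) by push_cast; rfl,
        Complex.norm_real, Real.norm_of_nonneg (by linarith)]
      have h1 := rWeight_mul_rWeight_le hne h.symm
      have h2 : 0 ≤ 5 * √(p : ℝ) * (rWeight v * rWeight v') := by positivity
      have h3 : 0 ≤ rWeight v * rWeight v' := by positivity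
      nlinarith
    · have hc : (n : ZMod p) * (((v : ZMod p)⁻¹) ^ 3 - ((v' : ZMod p)⁻¹) ^ 3) ≠ 0 := by
        refine mul_ne_zero hn (sub_ne_zero.2 fun heq => h ?_)
        rw [inv_pow, inv_pow] at heq
        exact (inv_injective heq).symm
      rw [if_neg h, mul_zero, add_zero, mul_comm]
      exact mul_le_mul_of_nonneg_right (norm_cubicSum_le hc) (by positivity)

theorem abs_sum_norm_kummerSum_mul_rPoly_sub_le {n : ℤ} (hn : (n : ZMod p) ≠ 0) :
    |(∑ χ : DirichletCharacter ℂ p, ‖kummerSum p n χ‖ ^ 2 * ‖rPoly χ‖ ^ 2)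
      - ((p : ℝ) - 1) ^ 2 * ∑ k ∈ Finset.Icc 1 (p - 1), rMul k ^ 2 / (k : ℝ) ^ 2|
      ≤ p * (√p * (11 + 16 * Real.log p)) := by
  have hp1 : (1 : ℝ) ≤ p := by exact_mod_cast (Fact.out : p.Prime).one_le
  have hdiag : ∑ k ∈ Finset.Icc 1 (p - 1), rMul k ^ 2 / (k : ℝ) ^ 2
      = ∑ v : (ZMod p)ˣ, rWeight v ^ 2 := by
    rw [← sum_units_val fun k : ℕ => rMul k ^ 2 / (k : ℝ) ^ 2]
    simp only [rWeight, div_pow]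
  have hmom := sum_norm_kummerSum_mul_sq n (rWeight (p := p))
  simp_rw [← rPoly_eq_sum_units, norm_mul, mul_pow] at hmom
  rw [hdiag, ← Real.norm_eq_abs, ← Complex.norm_real, Complex.ofReal_sub, hmom]
  have hdiag2 : (((p : ℝ) - 1) ^ 2 * ∑ v : (ZMod p)ˣ, rWeight v ^ 2 : ℝ)
      = ((p : ℂ) - 1) * ∑ v : (ZMod p)ˣ, ∑ v' : (ZMod p)ˣ,
        if v = v' then ((p : ℂ) - 1) * (rWeight v : ℂ) ^ 2 else 0 := by
    push_cast
    simp only [Finset.sum_ite_eq, Finset.mem_univ, if_true]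
    rw [← Finset.mul_sum]
    ring
  rw [hdiag2, ← mul_sub, norm_mul, show (p : ℂ) - 1 = ((p - 1 : ℝ) : ℂ) by push_cast; rfl,
    Complex.norm_real, Real.norm_of_nonneg (by linarith)]
  refine mul_le_mul (by linarith) ?_ (norm_nonneg _) (by linarith)
  simp only [← Finset.sum_sub_distrib]
  calc _ ≤ ∑ v : (ZMod p)ˣ, ∑ v' : (ZMod p)ˣ, (5 * √p * (rWeight v * rWeight v')
        + √p * (if (v' : ZMod p) ^ 3 = (v : ZMod p) ^ 3
          then 1 / ((v : ZMod p).val : ℝ) + 1 / ((v' : ZMod p).val : ℝ) else 0)) := by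
        refine norm_sum_le_of_le _ fun v _ => norm_sum_le_of_le _ fun v' _ => ?_
        have h := norm_cubicSum_sub_diagonal_le hn v v'
        push_cast
        exact h
    _ = 5 * √p * (∑ v : (ZMod p)ˣ, rWeight v) ^ 2
        + √p * ∑ v : (ZMod p)ˣ, ∑ v' : (ZMod p)ˣ, (if (v' : ZMod p) ^ 3 = (v : ZMod p) ^ 3
          then 1 / ((v : ZMod p).val : ℝ) + 1 / ((v' : ZMod p).val : ℝ) else 0) := by
        simp only [Finset.sum_add_distrib, ← Finset.mul_sum]
        rw [sq, Finset.sum_mul]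
    _ ≤ 5 * √p * (1 + 2 * Real.log p) + √p * (6 * (1 + Real.log p)) := by
        gcongr
        · exact sum_rWeight_sq_le
        · exact sum_one_div_val_cube_eq_le
    _ = _ := by ring

/-- Orthogonality needs all characters; this is the cost of discarding the principal one. -/
theorem norm_kummerSum_one_mul_rPoly_one_le {n : ℤ} (hn : (n : ZMod p) ≠ 0) :
    ‖kummerSum p n 1‖ ^ 2 * ‖rPoly (1 : DirichletCharacter ℂ p)‖ ^ 2
      ≤ 18 * p * (1 + 2 * Real.log p) := by
  have h : rPoly (1 : DirichletCharacter ℂ p) = ((∑ v : (ZMod p)ˣ, rWeight v : ℝ) : ℂ) := by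
    rw [rPoly_eq_sum_units]
    push_cast
    exact Finset.sum_congr rfl fun v _ => by simp
  rw [kummerSum_one, h, Complex.norm_real, Real.norm_eq_abs, sq_abs]
  exact mul_le_mul (norm_cubicSum_sq_le hn) sum_rWeight_sq_le (sq_nonneg _) (by positivity)

theorem constCt_val_le {a : ZMod p} (ha : a ^ 3 = 1) (ha1 : a ≠ 1) :
    constCt a.val ≤ 4 / √p := by
  have hp0 : (0 : ℝ) < p := by exact_mod_cast (Fact.out : p.Prime).pos
  have hpos : 0 < a.val := by
    refine Nat.pos_of_ne_zero fun h => ?_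
    rw [(ZMod.val_eq_zero a).1 h] at ha
    simp at ha
  have h := sqrt_le_add_of_cube_eq (p := p) (m := a.val) (n := 1) hpos (by simpa using ha1)
    (by simpa using ha)
  have h1 : (1 : ℝ) ≤ a.val := by exact_mod_cast hpos
  have hs : 0 < √(p : ℝ) := Real.sqrt_pos.2 hp0
  refine (constCt_le _).trans ?_
  rw [div_le_div_iff₀ (by linarith) hs]
  push_cast at h
  linarith

end MainTerm
-- Assembly of the estimates
theorem theorem3 :
    ∃ K : ℝ, ∀ (p : ℕ) [Fact p.Prime], p % 3 = 1 →
      ∀ n : ℤ, IsCoprime n (p : ℤ) →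
      ∀ a₁ : ZMod p, a₁ ^ 3 = 1 → a₁ ≠ 1 →
        |(∑ χ : DirichletCharacter ℂ p with χ ≠ 1,
              ‖kummerSum p n χ‖ ^ 2 * ‖DirichletCharacter.LFunction χ 1‖)
            - constC * (1 + constCt a₁.val + constCt (a₁⁻¹).val) * (p : ℝ) ^ 2|
          ≤ K * ((p : ℝ) ^ (3 / 2 : ℝ) * Real.log p) := by
  -- The sum of the constants in `e1` to `e5`: `11 + 54 + 27 + (2 + 2 C) + 8 C`.
  refine ⟨94 + 10 * constC, ?_⟩
  intro p _ hp3 n hn a ha ha1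
  have hp := (Fact.out : p.Prime)
  have hp3' : 3 ≤ p := by
    have := hp.two_le
    omega
  have hpR : (3 : ℝ) ≤ p := by exact_mod_cast hp3'
  have hn0 : (n : ZMod p) ≠ 0 := by
    rw [Ne, ZMod.intCast_zmod_eq_zero_iff_dvd]
    intro hdvd
    have hunit := hn.isUnit_of_dvd' hdvd dvd_rfl
    rw [Int.isUnit_iff] at hunit
    omega
  have hinv : a⁻¹ ^ 3 = 1 := by rw [inv_pow, ha, inv_one]
  have hinv1 : a⁻¹ ≠ 1 := fun h => ha1 (inv_eq_one.1 h)
  -- The congruence excludes `p = 2`, so `p ≥ 3 > e`; lower-order terms can then be absorbed into `p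
  -- √p log p`.
  have hL : 1 ≤ Real.log p := by
    rw [Real.le_log_iff_exp_le (by linarith)]
    linarith [Real.exp_one_lt_d9]
  have hC := constC_nonneg
  have hpow : (p : ℝ) ^ (3 / 2 : ℝ) = p * √p := by
    rw [show (3 / 2 : ℝ) = 1 + 1 / 2 by norm_num, Real.rpow_add (by linarith), Real.rpow_one,
      Real.sqrt_eq_rpow]
  have hq2 : √(p : ℝ) ^ 2 = p := Real.sq_sqrt (by linarith)
  have hq1 : 1 ≤ √(p : ℝ) := Real.one_le_sqrt.2 (by linarith)
  have hreplace := abs_sum_kummerSum_LFunction_sub_le (p := p) hn0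
  have hall := abs_sum_norm_kummerSum_mul_rPoly_sub_le (p := p) hn0
  have hone := norm_kummerSum_one_mul_rPoly_one_le (p := p) hn0
  have hone0 : 0 ≤ ‖kummerSum p n 1‖ ^ 2 * ‖rPoly (1 : DirichletCharacter ℂ p)‖ ^ 2 := by
    positivity
  have hsplit : ∑ χ : DirichletCharacter ℂ p, ‖kummerSum p n χ‖ ^ 2 * ‖rPoly χ‖ ^ 2
      = ‖kummerSum p n 1‖ ^ 2 * ‖rPoly (1 : DirichletCharacter ℂ p)‖ ^ 2
        + ∑ χ : DirichletCharacter ℂ p with χ ≠ 1, ‖kummerSum p n χ‖ ^ 2 * ‖rPoly χ‖ ^ 2 := by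
    rw [Finset.filter_ne']
    exact (Finset.add_sum_erase Finset.univ (fun χ : DirichletCharacter ℂ p =>
      ‖kummerSum p n χ‖ ^ 2 * ‖rPoly χ‖ ^ 2) (Finset.mem_univ 1)).symm
  have hDC := sum_Icc_rMul_sq_le_constC (p - 1)
  have hCD := constC_le_sum_Icc_add (p - 1)
  have hD0 : 0 ≤ ∑ k ∈ Finset.Icc 1 (p - 1), rMul k ^ 2 / (k : ℝ) ^ 2 :=
    Finset.sum_nonneg fun _ _ => by positivity
  rw [Nat.cast_sub hp.one_le, Nat.cast_one, sub_add_cancel] at hCD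
  have ht := constCt_val_le ha ha1
  have ht' := constCt_val_le hinv hinv1
  have ht0 := constCt_nonneg a.val
  have ht0' := constCt_nonneg (a⁻¹).val
  have hsqrt : √(21 * (p : ℝ) ^ 3) ≤ 5 * (p * √p) := by
    refine Real.sqrt_le_iff.2 ⟨by positivity, ?_⟩
    rw [mul_pow, mul_pow, hq2]
    nlinarith [pow_pos (by linarith : (0 : ℝ) < p) 3]
  rw [hpow]
  generalize constCt a.val = t at *
  generalize constCt (a⁻¹).val = t' at *
  generalize ∑ k ∈ Finset.Icc 1 (p - 1), rMul k ^ 2 / (k : ℝ) ^ 2 = D at *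
  generalize ‖kummerSum p n 1‖ ^ 2 * ‖rPoly (1 : DirichletCharacter ℂ p)‖ ^ 2 = o at *
  generalize (∑ χ : DirichletCharacter ℂ p, ‖kummerSum p n χ‖ ^ 2 * ‖rPoly χ‖ ^ 2) = Sall at *
  generalize (∑ χ : DirichletCharacter ℂ p with χ ≠ 1,
    ‖kummerSum p n χ‖ ^ 2 * ‖rPoly χ‖ ^ 2) = Spoly at *
  generalize (∑ χ : DirichletCharacter ℂ p with χ ≠ 1,
    ‖kummerSum p n χ‖ ^ 2 * ‖DirichletCharacter.LFunction χ 1‖) = Smain at *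
  generalize Real.log (p : ℝ) = l at *
  generalize √(21 * (p : ℝ) ^ 3) = s at *
  generalize constC = c at *
  have hX : (p : ℝ) * l ≤ p * √p * l := by
    have h1 : (p : ℝ) * 1 ≤ p * √p := mul_le_mul_of_nonneg_left hq1 (by linarith)
    nlinarith
  have hpl : (p : ℝ) ≤ p * l := by nlinarith
  have hpql : (p : ℝ) * √p ≤ p * √p * l := by
    nlinarith [mul_nonneg (by linarith : (0 : ℝ) ≤ p) (by linarith : (0 : ℝ) ≤ √(p : ℝ))]
  have e1 : |Smain - Spoly| ≤ 11 * (p * √p * l) := by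
    refine hreplace.trans ?_
    have : s * (1 + l) ≤ 5 * (p * √p) * (1 + l) :=
      mul_le_mul_of_nonneg_right hsqrt (by linarith)
    linarith
  have e2 : |Spoly - Sall| ≤ 54 * (p * √p * l) := by
    rw [hsplit, abs_le]
    constructor <;> linarith
  have e3 : |Sall - ((p : ℝ) - 1) ^ 2 * D| ≤ 27 * (p * √p * l) := by
    refine hall.trans ?_
    linarith
  -- The difference is `-p² (C - D) - (2 p - 1) D`: the series tail beyond `p - 1` and the
  -- replacement of `(p - 1)²` by `p²` each cost `O(p)`.
  have e4 : |((p : ℝ) - 1) ^ 2 * D - c * (p : ℝ) ^ 2| ≤ (2 + 2 * c) * (p * √p * l) := by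
    have h1 : (p : ℝ) ^ 2 * (c - D) ≤ 2 * p := by
      calc (p : ℝ) ^ 2 * (c - D) ≤ (p : ℝ) ^ 2 * (2 / (p : ℝ)) := by gcongr; linarith
        _ = 2 * (p : ℝ) := by field_simp
    have h2 : 0 ≤ (p : ℝ) ^ 2 * (c - D) := mul_nonneg (sq_nonneg _) (by linarith)
    have h3 : (2 * (p : ℝ) - 1) * D ≤ 2 * p * c := by
      refine mul_le_mul (by linarith) hDC hD0 (by linarith)
    have h4 : 0 ≤ (2 * (p : ℝ) - 1) * D := mul_nonneg (by linarith) hD0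
    have h5 : (2 + 2 * c) * p ≤ (2 + 2 * c) * (p * √p * l) :=
      mul_le_mul_of_nonneg_left (hpl.trans hX) (by linarith)
    rw [abs_le]
    constructor <;> linarith
  -- The secondary terms are inserted at the price of an error, since each is at most `4 / √p`.
  have e5 : |c * (p : ℝ) ^ 2 - c * (1 + t + t') * (p : ℝ) ^ 2| ≤ 8 * c * (p * √p * l) := by
    have h1 : (t + t') * (p : ℝ) ^ 2 ≤ 8 * (p * √p) := by
      calc (t + t') * (p : ℝ) ^ 2 ≤ (8 / √p) * (p : ℝ) ^ 2 := by
            gcongr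
            calc t + t' ≤ 4 / √p + 4 / √p := add_le_add ht ht'
              _ = 8 / √p := by ring
        _ = 8 * (p * (p / √p)) := by ring
        _ = 8 * (p * √p) := by rw [Real.div_sqrt]
    have h2 : 0 ≤ (t + t') * (p : ℝ) ^ 2 := by positivity
    have h3 : c * ((t + t') * (p : ℝ) ^ 2) ≤ c * (8 * (p * √p * l)) :=
      mul_le_mul_of_nonneg_left (by linarith) hC
    have h4 : 0 ≤ c * ((t + t') * (p : ℝ) ^ 2) := mul_nonneg hC h2
    rw [abs_le]
    constructor <;> linarith
  rw [abs_le] at *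
  constructor <;> linarith
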